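/- There exists a universal constant $\alpha>0$ such that the following holds for every integer $d\ge 1$. Let $\mathcal X=\mathbb R^d$ and let $\mathcal H_d\subseteq\{0,1\}^{\mathcal X}$ be the class of (indicator functions of) closed half-spaces $\{x\in\mathbb R^d:\langle w,x\rangle\ge b\}$, with $w\in\mathbb R^d\setminus\{0\}$ and $b\in\mathbb R$. For a probability distribution $\mathcal D$ on $\mathcal X\times\{0,1\}$ and $h:\mathcal X\to\{0,1\}$ write $L_{\mathcal D}(h)=\Pr_{(x,y)\sim\mathcal D}[h(x)\ne y]$, and call $\mathcal D$ realizable for $\mathcal H_d$ if $\inf_{h\in\mathcal H_d}L_{\mathcal D}(h)=0$. A learning algorithm $\hat h$ is a (measurable, possibly randomized) map that takes a finite sample $S\in(\mathcal X\times\{0,1\})^n$, for any $n$, to a function $\hat h_S:\mathcal X\to\{0,1\}$. Then for every learning algorithm $\hat h$ there exists a distribution $\mathcal D$, realizable for $\mathcal H_d$, such that the inequality $$\mathbb E_{S\sim\mathcal D^n}\big[L_{\mathcal D}(\hat h_S)\big]\ \ge\ \alpha\cdot\frac dn$$ holds for infinitely many $n\in\mathbb N$, where the expectation is over the i.i.d.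 sample $S$ and the internal randomness of $\hat h$. -/

import Mathlib

open MeasureTheory
open scoped ENNReal RealInnerProductSpace

namespace LearningCurves

/-- A (possibly randomized) learning algorithm for functions `X → {0,1}`. The random seed `ω` is
drawn from the probability space `(Ω, seed)`, independently of the sample; `predict n ω S` is the
function `X → {0,1}` that is output on the sample `S ∈ (X × {0,1})ⁿ` with seed `ω`.

The measurability condition is the weakest usual one. When `Ω` is a one-point space (a deterministic
algorithm) it says that `(S, x) ↦ predict n ω S x` is universally measurable for every `n`.
Jointly Borel measurable algorithms also satisfy it. -/
structure LearningAlgorithm (Ω X : Type*) [MeasurableSpace Ω] [MeasurableSpace X] where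
  seed : Measure Ω
  isProbabilityMeasure_seed : IsProbabilityMeasure seed
  predict : (n : ℕ) → Ω → (Fin n → X × Bool) → X → Bool
  nullMeasurable_predict : ∀ (n : ℕ) (ν : Measure ((Fin n → X × Bool) × X)),
    IsProbabilityMeasure ν →
      NullMeasurable
        (fun p : Ω × ((Fin n → X × Bool) × X) => predict n p.1 p.2.1 p.2.2) (seed.prod ν)

/-- The 0-1 loss `P_{(x,y) ∼ D}[h(x) ≠ y]`. -/
def loss {X : Type*} [MeasurableSpace X] (D : Measure (X × Bool)) (h : X → Bool) : ℝ≥0∞ :=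
  D {z | h z.1 ≠ z.2}

/-- The set of realizable distributions for the hypothesis class `H`. -/
def Realizable {X : Type*} [MeasurableSpace X] (H : Set (X → Bool)) : Set (Measure (X × Bool)) :=
  {D | IsProbabilityMeasure D ∧ ⨅ h ∈ H, loss D h = 0}

/-- The expected 0-1 loss with respect to `D` of the output of the algorithm `A` on a sample of `n`
i.i.d. points from `D`; the expectation is over the sample and the seed of `A`. -/
noncomputable def expectedLoss {Ω X : Type*} [MeasurableSpace Ω] [MeasurableSpace X]
    (A : LearningAlgorithm Ω X) (D : Measure (X × Bool)) (n : ℕ) : ℝ≥0∞ :=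
  ∫⁻ p : Ω × (Fin n → X × Bool), loss D (A.predict n p.1 p.2)
    ∂(A.seed.prod (Measure.pi fun _ : Fin n => D))

/-- The class of (indicator functions of) closed half-spaces `{x | b ≤ ⟨w, x⟩}`, `w ≠ 0`, in
`ℝ^d`. -/
def closedHalfSpaces (d : ℕ) : Set (EuclideanSpace ℝ (Fin d) → Bool) :=
  {h | ∃ w : EuclideanSpace ℝ (Fin d), w ≠ 0 ∧ ∃ b : ℝ, ∀ x, h x = true ↔ b ≤ ⟪w, x⟫}

end LearningCurves

/-! Nature labels the nodes of an infinite tree of width `|ι|` level by level, the labels of each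
level determining which points of `X` sit at the later nodes. A random node is drawn from a
distribution under which every node of level `k`, and the whole of the levels above `k`, has the
same mass `q = (|ι| + 1)⁻¹ ^ (k + 1)`. A sample of size `n = q⁻¹` then has a constant chance of
missing a given node of level `k` together with all later levels, in which case it says nothing
about the label of that node. Hence some labeling of level `k` makes the algorithm err with constant
probability at a typical node of the level, which costs a loss of order `|ι| * q = |ι| / n`. Since
the event only involves the labels up to level `k`, a single infinite branch is bad for all `k`.

On the `i`-th axis of `ℝ^d` the half-space `{x | 1 ≤ ⟪w, x⟫}` acts as a threshold at `1 / w i`.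
Bisection for the numbers `w i`, carried out on all the axes at once, is therefore an infinite tree
of width `d` whose labels are arbitrary. -/

namespace LearningCurves

section Choice

theorem exists_forall_of_forall_exists_update {ι : Type*} {β : ι → Type*} [PartialOrder ι]
    [WellFoundedLT ι] [DecidableEq ι] [∀ k, Nonempty (β k)] (P : ι → (∀ k, β k) → Prop)
    (hcongr : ∀ k a a', (∀ l ≤ k, a l = a' l) → P k a → P k a')
    (hex : ∀ k a, ∃ b, P k (Function.update a k b)) : ∃ a, ∀ k, P k a := by
  classical
  choose b hb using hex
  let extend (k : ι) (u : ∀ l, l < k → β l) (l : ι) : β l :=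
    if h : l < k then u l h else Classical.arbitrary _
  let a : ∀ k, β k := wellFounded_lt.fix fun k u => b k (extend k u)
  have ha : ∀ k, a k = b k (extend k fun l _ => a l) := fun k => wellFounded_lt.fix_eq _ k
  refine ⟨a, fun k => hcongr k _ _ (fun l hl => ?_) (hb k (extend k fun l _ => a l))⟩
  rcases hl.lt_or_eq with hlt | rfl
  · rw [Function.update_of_ne hlt.ne]
    exact dif_pos hlt
  · rw [Function.update_self, ha]

variable {ι : Type*} [DecidableEq ι]

/-- The labeling `b` with the label of `i` negated. -/
def flipAt (i : ι) (b : ι → Bool) : ι → Bool :=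
  Function.update b i (!b i)

theorem flipAt_involutive (i : ι) : Function.Involutive (flipAt i) := fun b => by
  simp [flipAt]

theorem exists_sum_le_two_mul_sum_of_le_add_flipAt [Fintype ι] {c : ι → ℝ≥0∞}
    {f : ι → (ι → Bool) → ℝ≥0∞} (h : ∀ i b, c i ≤ f i b + f i (flipAt i b)) :
    ∃ b, ∑ i, c i ≤ 2 * ∑ i, f i b := by
  have sum_flipAt (i : ι) : ∑ b, f i (flipAt i b) = ∑ b, f i b :=
    Equiv.sum_comp (flipAt_involutive i).toPerm (f i)
  have sum_le : ∑ b : ι → Bool, ∑ i, c i ≤ ∑ b, 2 * ∑ i, f i b :=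
    calc ∑ b : ι → Bool, ∑ i, c i
        ≤ ∑ b, ∑ i, (f i b + f i (flipAt i b)) := by gcongr with b _ i _; exact h i b
      _ = ∑ i, 2 * ∑ b, f i b := by
        rw [Finset.sum_comm]
        simp only [Finset.sum_add_distrib, sum_flipAt, two_mul]
      _ = ∑ b, 2 * ∑ i, f i b := by rw [← Finset.mul_sum, Finset.sum_comm, Finset.mul_sum]
  obtain ⟨b, -, hb⟩ := ENNReal.exists_le_of_sum_le Finset.univ_nonempty sum_le
  exact ⟨b, hb⟩

end Choice

section Algorithm

variable {Ω X T : Type*} [MeasurableSpace Ω] [MeasurableSpace X] [MeasurableSpace T]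

instance (A : LearningAlgorithm Ω X) : IsProbabilityMeasure A.seed :=
  A.isProbabilityMeasure_seed

theorem LearningAlgorithm.nullMeasurableSet_predict_ne (A : LearningAlgorithm Ω X) (n : ℕ)
    (μ : Measure (Fin n → X × Bool)) [IsProbabilityMeasure μ] (z : X) (y : Bool) :
    NullMeasurableSet {p : Ω × (Fin n → X × Bool) | A.predict n p.1 p.2 z ≠ y}
      (A.seed.prod μ) := by
  have measurable_pair : Measurable fun S : Fin n → X × Bool => (S, z) := by fun_prop
  have := Measure.isProbabilityMeasure_map (μ := μ) measurable_pair.aemeasurable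
  have preserving : MeasurePreserving (Prod.map id fun S : Fin n → X × Bool => (S, z))
      (A.seed.prod μ) (A.seed.prod (μ.map fun S => (S, z))) :=
    (MeasurePreserving.id _).prod ⟨measurable_pair, rfl⟩
  exact (A.nullMeasurable_predict n _ this (MeasurableSet.of_discrete (s := {y}ᶜ))).preimage
    preserving.quasiMeasurePreserving

theorem sum_indicator_le_loss_map [MeasurableSingletonClass T] (Q : Measure T)
    {f : T → X × Bool} (hf : AEMeasurable f Q) (h : X → Bool) (s : Finset T) :
    ∑ t ∈ s, {t | h (f t).1 ≠ (f t).2}.indicator (fun t => Q {t}) t ≤ loss (Q.map f) h := by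
  classical
  calc ∑ t ∈ s, {t | h (f t).1 ≠ (f t).2}.indicator (fun t => Q {t}) t
      = Q ↑(s.filter fun t => h (f t).1 ≠ (f t).2) := by
        rw [← sum_measure_singleton, Finset.sum_filter]
        simp only [Set.indicator_apply, Set.mem_ofPred_eq]
    _ ≤ Q (f ⁻¹' {z | h z.1 ≠ z.2}) :=
        measure_mono fun t ht => (Finset.mem_filter.1 (Finset.mem_coe.1 ht)).2
    _ ≤ loss (Q.map f) h := Measure.le_map_apply hf _

theorem sum_measure_singleton_mul_le_expectedLoss_map [MeasurableSingletonClass T]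
    (A : LearningAlgorithm Ω X) (Q : Measure T) [IsProbabilityMeasure Q] {f : T → X × Bool}
    (hf : Measurable f) (n : ℕ) (s : Finset T) :
    ∑ t ∈ s, Q {t} * (A.seed.prod (Measure.pi fun _ : Fin n => Q))
        {p | A.predict n p.1 (f ∘ p.2) (f t).1 ≠ (f t).2} ≤ expectedLoss A (Q.map f) n := by
  have := Measure.isProbabilityMeasure_map (μ := Q) hf.aemeasurable
  set D := Q.map f with hD
  let err (t : T) : Set (Ω × (Fin n → X × Bool)) := {p | A.predict n p.1 p.2 (f t).1 ≠ (f t).2}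
  have err_null (t : T) : NullMeasurableSet (err t) (A.seed.prod (Measure.pi fun _ => D)) :=
    A.nullMeasurableSet_predict_ne n _ _ _
  have sample_measurable : Measurable fun S : Fin n → T => f ∘ S :=
    measurable_pi_lambda _ fun j => hf.comp (measurable_pi_apply j)
  have sample_law : A.seed.prod (Measure.pi fun _ : Fin n => D) =
      (A.seed.prod (Measure.pi fun _ : Fin n => Q)).map (Prod.map id fun S => f ∘ S) := by
    rw [← Measure.map_prod_map _ _ measurable_id sample_measurable, Measure.map_id, hD,
      ← Measure.pi_map_pi fun _ => hf.aemeasurable]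
    rfl
  calc ∑ t ∈ s, Q {t} * (A.seed.prod (Measure.pi fun _ : Fin n => Q))
        {p | A.predict n p.1 (f ∘ p.2) (f t).1 ≠ (f t).2}
      ≤ ∑ t ∈ s, Q {t} * (A.seed.prod (Measure.pi fun _ => D)) (err t) := by
        gcongr with t
        rw [sample_law]
        exact Measure.le_map_apply (measurable_id.prodMap sample_measurable).aemeasurable (err t)
    _ = ∫⁻ p, ∑ t ∈ s, (err t).indicator (fun _ => Q {t}) p
          ∂(A.seed.prod (Measure.pi fun _ => D)) := by
        rw [lintegral_finsetSum' _ fun t _ => aemeasurable_const.indicator₀ (err_null t)]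
        simp only [lintegral_indicator_const₀ (err_null _)]
    _ ≤ expectedLoss A D n :=
        lintegral_mono fun p => sum_indicator_le_loss_map Q hf.aemeasurable (A.predict n p.1 p.2) s

end Algorithm

section Tree

variable {Ω X ι : Type*}

/-- A tree of points of `X` with `|ι|` nodes on each level, where `x a k i` is the `i`-th node of
level `k` on the branch `a : ℕ → ι → Bool`, is predictable if the nodes of level `k` only depend on
the labels `a` puts on the earlier levels. Encoding the nodes by infinite branches avoids dependent
types. -/
def IsPredictable (x : (ℕ → ι → Bool) → ℕ → ι → X) : Prop :=
  ∀ ⦃a a' : ℕ → ι → Bool⦄ ⦃k : ℕ⦄, (∀ l < k, a l = a' l) → x a k = x a' k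

/-- An infinite VCL (Vapnik–Chervonenkis–Littlestone) tree of width `|ι|` for the class `H`: every
finite initial segment of a branch is realized by a member of `H`. -/
structure IsVCLTree (H : Set (X → Bool)) (x : (ℕ → ι → Bool) → ℕ → ι → X) : Prop where
  predictable : IsPredictable x
  exists_mem_forall_lt_eq : ∀ a m, ∃ h ∈ H, ∀ k < m, ∀ i, h (x a k i) = a k i

/-- The example at the node `t = (k, i)` of the branch `a`. -/
def labeledNode (x : (ℕ → ι → Bool) → ℕ → ι → X) (a : ℕ → ι → Bool) (t : ℕ × ι) : X × Bool :=
  (x a t.1 t.2, a t.1 t.2)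

/-- The nodes up to level `k` other than `(k, i)`. A sample from these nodes carries no information
on the label of `(k, i)`. -/
def otherNodes (k : ℕ) (i : ι) : Set (ℕ × ι) :=
  Set.Iic k ×ˢ Set.univ \ {(k, i)}

variable {x : (ℕ → ι → Bool) → ℕ → ι → X} {a a' : ℕ → ι → Bool} {k : ℕ} {i : ι}

theorem IsPredictable.eq_of_forall_otherNodes (hx : IsPredictable x)
    (h : ∀ t ∈ otherNodes k i, a t.1 t.2 = a' t.1 t.2) {l : ℕ} (hl : l ≤ k) : x a l = x a' l :=
  hx fun m hm => funext fun j => h (m, j)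
    ⟨⟨(hm.trans_le hl).le, trivial⟩, fun hmj => (hm.trans_le hl).ne (congrArg Prod.fst hmj)⟩

theorem IsPredictable.eqOn_labeledNode (hx : IsPredictable x)
    (h : ∀ t ∈ otherNodes k i, a t.1 t.2 = a' t.1 t.2) :
    Set.EqOn (labeledNode x a) (labeledNode x a') (otherNodes k i) := fun t ht =>
  Prod.ext (congrFun (hx.eq_of_forall_otherNodes h ht.1.1) t.2) (h t ht)

variable [MeasurableSpace Ω] [MeasurableSpace X]

/-- The event that all nodes in a sample of size `n` are in `otherNodes k i`, and the algorithm errs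
at the node `(k, i)`. -/
def errorEvent (A : LearningAlgorithm Ω X) (x : (ℕ → ι → Bool) → ℕ → ι → X)
    (a : ℕ → ι → Bool) (n k : ℕ) (i : ι) : Set (Ω × (Fin n → ℕ × ι)) :=
  {p | (∀ j, p.2 j ∈ otherNodes k i) ∧
    A.predict n p.1 (labeledNode x a ∘ p.2) (x a k i) ≠ a k i}

theorem IsPredictable.predict_comp_labeledNode_eq (hx : IsPredictable x)
    (A : LearningAlgorithm Ω X) (h : ∀ t ∈ otherNodes k i, a t.1 t.2 = a' t.1 t.2) {n : ℕ} (ω : Ω)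
    {S : Fin n → ℕ × ι} (hS : ∀ j, S j ∈ otherNodes k i) :
    A.predict n ω (labeledNode x a ∘ S) (x a k i) =
      A.predict n ω (labeledNode x a' ∘ S) (x a' k i) := by
  have sample_eq : labeledNode x a ∘ S = labeledNode x a' ∘ S :=
    funext fun j => hx.eqOn_labeledNode h (hS j)
  rw [sample_eq, hx.eq_of_forall_otherNodes h le_rfl]

theorem IsPredictable.errorEvent_congr (hx : IsPredictable x) (A : LearningAlgorithm Ω X) (n : ℕ)
    (i : ι) (h : ∀ l ≤ k, a l = a' l) : errorEvent A x a n k i = errorEvent A x a' n k i := by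
  ext p
  refine and_congr_right fun hp => ?_
  rw [hx.predict_comp_labeledNode_eq A (fun t ht => congrFun (h t.1 ht.1.1) t.2) p.1 hp,
    h k le_rfl]

theorem IsPredictable.univ_prod_pi_otherNodes_subset (hx : IsPredictable x)
    (A : LearningAlgorithm Ω X) (n : ℕ) (h : ∀ t ∈ otherNodes k i, a t.1 t.2 = a' t.1 t.2)
    (hne : a k i ≠ a' k i) :
    (Set.univ : Set Ω) ×ˢ (Set.univ.pi fun _ : Fin n => otherNodes k i) ⊆
      errorEvent A x a n k i ∪ errorEvent A x a' n k i := by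
  rintro ⟨ω, S⟩ ⟨-, hS⟩
  replace hS (j : Fin n) : S j ∈ otherNodes k i := hS j trivial
  have predict_eq := hx.predict_comp_labeledNode_eq A h ω hS
  by_cases herr : A.predict n ω (labeledNode x a ∘ S) (x a k i) = a k i
  · exact .inr ⟨hS, by rwa [← predict_eq, herr]⟩
  · exact .inl ⟨hS, herr⟩

end Tree

section RandomNode

variable {Ω X ι : Type*} [MeasurableSpace Ω] [MeasurableSpace X] [MeasurableSpace ι]
  {x : (ℕ → ι → Bool) → ℕ → ι → X}

theorem IsPredictable.exists_update_sum_le_two_mul_sum_errorEvent [Fintype ι]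
    (hx : IsPredictable x) (A : LearningAlgorithm Ω X) (Q : Measure (ℕ × ι)) [SigmaFinite Q]
    (n k : ℕ) (a : ℕ → ι → Bool) :
    ∃ b, ∑ i, Q (otherNodes k i) ^ n ≤ 2 * ∑ i, (A.seed.prod (Measure.pi fun _ => Q))
      (errorEvent A x (Function.update a k b) n k i) := by
  classical
  refine exists_sum_le_two_mul_sum_of_le_add_flipAt fun i b => ?_
  have label_eq : ∀ t ∈ otherNodes k i, Function.update a k b t.1 t.2 =
      Function.update a k (flipAt i b) t.1 t.2 := by
    rintro ⟨l, j⟩ ⟨-, hne⟩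
    rcases eq_or_ne l k with rfl | hl
    · have hj : j ≠ i := fun hj => hne (congrArg (Prod.mk l) hj)
      simp [flipAt, hj]
    · simp [hl]
  have label_ne : Function.update a k b k i ≠ Function.update a k (flipAt i b) k i := by
    simp [flipAt]
  calc Q (otherNodes k i) ^ n
      = (A.seed.prod (Measure.pi fun _ => Q))
          (Set.univ ×ˢ Set.univ.pi fun _ : Fin n => otherNodes k i) := by
        simp [Measure.prod_prod, Measure.pi_pi]
    _ ≤ _ := measure_mono (hx.univ_prod_pi_otherNodes_subset A n label_eq label_ne)
    _ ≤ _ := measure_union_le _ _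

theorem IsPredictable.exists_forall_sum_le_two_mul_sum_errorEvent [Fintype ι]
    (hx : IsPredictable x) (A : LearningAlgorithm Ω X) (Q : Measure (ℕ × ι)) [SigmaFinite Q]
    (N : ℕ → ℕ) :
    ∃ a, ∀ k, ∑ i, Q (otherNodes k i) ^ N k ≤
      2 * ∑ i, (A.seed.prod (Measure.pi fun _ => Q)) (errorEvent A x a (N k) k i) := by
  refine exists_forall_of_forall_exists_update _ (fun k a a' h hk => ?_)
    fun k a => hx.exists_update_sum_le_two_mul_sum_errorEvent A Q (N k) k a
  simpa only [hx.errorEvent_congr A (N k) _ h] using hk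

variable [MeasurableSingletonClass ι]

theorem measurable_labeledNode [Countable ι] (a : ℕ → ι → Bool) : Measurable (labeledNode x a) :=
  .of_discrete

theorem sum_measure_singleton_mul_errorEvent_le_expectedLoss [Fintype ι]
    (A : LearningAlgorithm Ω X) (Q : Measure (ℕ × ι)) [IsProbabilityMeasure Q]
    (a : ℕ → ι → Bool) (n k : ℕ) :
    ∑ i, Q {(k, i)} * (A.seed.prod (Measure.pi fun _ => Q)) (errorEvent A x a n k i) ≤
      expectedLoss A (Q.map (labeledNode x a)) n := by
  classical
  refine le_trans ?_ (sum_measure_singleton_mul_le_expectedLoss_map A Q (measurable_labeledNode a)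
    n ({k} ×ˢ Finset.univ))
  rw [Finset.sum_product, Finset.sum_singleton]
  gcongr with i
  exact fun p hp => hp.2

theorem IsVCLTree.map_labeledNode_mem_realizable [Countable ι] {H : Set (X → Bool)}
    (hx : IsVCLTree H x) (hH : ∀ h ∈ H, Measurable h) (Q : Measure (ℕ × ι))
    [IsProbabilityMeasure Q] (a : ℕ → ι → Bool) : Q.map (labeledNode x a) ∈ Realizable H := by
  refine ⟨Measure.isProbabilityMeasure_map (measurable_labeledNode a).aemeasurable, ?_⟩
  let tail (m : ℕ) : Set (ℕ × ι) := {t | m ≤ t.1}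
  have iInf_loss_le_tail (m : ℕ) : ⨅ h ∈ H, loss (Q.map (labeledNode x a)) h ≤ Q (tail m) := by
    obtain ⟨h, hmem, hcons⟩ := hx.exists_mem_forall_lt_eq a m
    refine (iInf₂_le h hmem).trans ?_
    have errors_measurable : MeasurableSet {z : X × Bool | h z.1 ≠ z.2} :=
      (measurableSet_eq_fun ((hH h hmem).comp measurable_fst) measurable_snd).compl
    rw [loss, Measure.map_apply (measurable_labeledNode a) errors_measurable]
    exact measure_mono fun t ht => not_lt.1 fun hlt => ht (hcons t.1 hlt t.2)
  have tail_antitone : Antitone tail := fun m m' hm t ht => hm.trans ht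
  have tail_iInter : ⋂ m, tail m = ∅ :=
    Set.iInter_eq_empty_iff.2 fun t => ⟨t.1 + 1, Nat.not_succ_le_self t.1⟩
  have tail_tendsto := tendsto_measure_iInter_atTop (μ := Q)
    (fun m => MeasurableSet.of_discrete.nullMeasurableSet) tail_antitone ⟨0, measure_ne_top Q _⟩
  rw [tail_iInter, measure_empty] at tail_tendsto
  exact le_antisymm (ge_of_tendsto' tail_tendsto iInf_loss_le_tail) bot_le

end RandomNode

section NodeMeasure

theorem geometricMeasure_real_Iic {p : unitInterval} (hp : p ≠ 0) (k : ℕ) :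
    (ProbabilityTheory.geometricMeasure p).real (Set.Iic k) = 1 - (1 - p : ℝ) ^ (k + 1) := by
  have hIic : Set.Iic k = (Finset.range (k + 1) : Set ℕ) := by
    ext l
    simp
  rw [hIic, ← sum_measureReal_singleton]
  simp only [ProbabilityTheory.geometricMeasure_real_singleton hp]
  rw [← Finset.sum_mul]
  linear_combination mul_neg_geom_sum (1 - p : ℝ) (k + 1)

variable (ι : Type*) [Fintype ι]

/-- The success probability `|ι| / (|ι| + 1)` of the geometric distribution of the level of a random
node. It is the value for which a node of a given level is as likely as all later levels
together. -/
noncomputable def levelParameter : unitInterval :=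
  ⟨Fintype.card ι / (Fintype.card ι + 1),
    unitInterval.div_mem (by positivity) (by positivity) (by linarith)⟩

theorem one_sub_levelParameter : 1 - (levelParameter ι : ℝ) = (Fintype.card ι + 1 : ℝ)⁻¹ := by
  simp only [levelParameter]
  field_simp
  ring

variable [Nonempty ι]

theorem levelParameter_ne_zero : levelParameter ι ≠ 0 := by
  have : (0 : ℝ) < Fintype.card ι := by exact_mod_cast Fintype.card_pos
  refine Subtype.coe_injective.ne_iff.1 (ne_of_gt ?_)
  simp only [levelParameter, Set.Icc.coe_zero]
  positivity

variable [MeasurableSpace ι] [MeasurableSingletonClass ι]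

/-- The distribution of a random node of a tree of width `|ι|`: the level is geometric, and the
position in the level is uniform. -/
noncomputable def nodeMeasure : Measure (ℕ × ι) :=
  (ProbabilityTheory.geometricMeasure (levelParameter ι)).prod
    (ProbabilityTheory.uniformOn Set.univ)

instance : IsProbabilityMeasure (nodeMeasure ι) := by
  unfold nodeMeasure
  infer_instance

variable {ι}

theorem nodeMeasure_real_singleton (k : ℕ) (i : ι) :
    (nodeMeasure ι).real {(k, i)} = ((Fintype.card ι + 1 : ℝ) ^ (k + 1))⁻¹ := by
  have : (0 : ℝ) < Fintype.card ι := by exact_mod_cast Fintype.card_pos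
  have uniform_singleton : (ProbabilityTheory.uniformOn Set.univ : Measure ι).real {i} =
      (Fintype.card ι : ℝ)⁻¹ := by
    simp [measureReal_def, ProbabilityTheory.uniformOn_univ]
  rw [← Set.singleton_prod_singleton, nodeMeasure, measureReal_prod_prod, uniform_singleton,
    ProbabilityTheory.geometricMeasure_real_singleton (levelParameter_ne_zero ι),
    one_sub_levelParameter, levelParameter, inv_pow]
  field_simp
  exact pow_succ' _ k

theorem nodeMeasure_real_otherNodes (k : ℕ) (i : ι) :
    (nodeMeasure ι).real (otherNodes k i) = 1 - 2 / (Fintype.card ι + 1 : ℝ) ^ (k + 1) := by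
  have node_subset : {(k, i)} ⊆ Set.Iic k ×ˢ (Set.univ : Set ι) := by simp
  have real_Iic_prod : (nodeMeasure ι).real (Set.Iic k ×ˢ Set.univ) =
      1 - ((Fintype.card ι + 1 : ℝ) ^ (k + 1))⁻¹ := by
    rw [nodeMeasure, measureReal_prod_prod, geometricMeasure_real_Iic (levelParameter_ne_zero ι),
      probReal_univ, mul_one, one_sub_levelParameter, inv_pow]
  rw [otherNodes, measureReal_sdiff node_subset (measurableSet_singleton _), real_Iic_prod,
    nodeMeasure_real_singleton]
  ring

theorem one_div_sixteen_le_one_sub_two_div_pow {n : ℕ} (hn : 4 ≤ n) :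
    (1 / 16 : ℝ) ≤ (1 - 2 / n) ^ n := by
  have hn' : (4 : ℝ) ≤ n := by exact_mod_cast hn
  have base_nonneg : (0 : ℝ) ≤ 1 - 2 / n := by
    rw [sub_nonneg, div_le_one (by linarith)]
    linarith
  have bernoulli : (1 / 2 : ℝ) ≤ (1 - 2 / n) ^ (n / 4 : ℝ) :=
    calc (1 / 2 : ℝ) = 1 + n / 4 * (-(2 / n)) := by field_simp; norm_num
      _ ≤ (1 + -(2 / n)) ^ (n / 4 : ℝ) :=
        one_add_mul_self_le_rpow_one_add (by linarith) (by linarith)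
      _ = (1 - 2 / n) ^ (n / 4 : ℝ) := by rw [← sub_eq_add_neg]
  calc (1 / 16 : ℝ) = (1 / 2) ^ 4 := by norm_num
    _ ≤ ((1 - 2 / n) ^ (n / 4 : ℝ)) ^ 4 := by gcongr
    _ = (1 - 2 / n) ^ n := by
      rw [← Real.rpow_mul_natCast base_nonneg, ← Real.rpow_natCast]
      congr 1
      push_cast
      ring

theorem one_div_sixteen_le_nodeMeasure_otherNodes_pow {k : ℕ} (hk : 1 ≤ k) (i : ι) :
    ENNReal.ofReal (1 / 16) ≤ nodeMeasure ι (otherNodes k i) ^ (Fintype.card ι + 1) ^ (k + 1) := by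
  have four_le : 4 ≤ (Fintype.card ι + 1) ^ (k + 1) :=
    calc 4 = 2 ^ 2 := by norm_num
      _ ≤ (Fintype.card ι + 1) ^ 2 := by gcongr; exact Nat.succ_le_succ Fintype.card_pos
      _ ≤ (Fintype.card ι + 1) ^ (k + 1) := Nat.pow_le_pow_right (by omega) (by omega)
  rw [← ofReal_measureReal, ← ENNReal.ofReal_pow measureReal_nonneg, nodeMeasure_real_otherNodes]
  exact ENNReal.ofReal_le_ofReal (by exact_mod_cast one_div_sixteen_le_one_sub_two_div_pow four_le)

end NodeMeasure

section LowerBound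

variable {Ω X ι : Type*} [MeasurableSpace Ω] [MeasurableSpace X] [Fintype ι] [Nonempty ι]
  [MeasurableSpace ι] [MeasurableSingletonClass ι] {x : (ℕ → ι → Bool) → ℕ → ι → X}

theorem le_expectedLoss_of_sum_le_two_mul_sum_errorEvent (A : LearningAlgorithm Ω X)
    {a : ℕ → ι → Bool} {k n : ℕ} (hk : 1 ≤ k) (hn : n = (Fintype.card ι + 1) ^ (k + 1))
    (ha : ∑ i, nodeMeasure ι (otherNodes k i) ^ n ≤
      2 * ∑ i, (A.seed.prod (Measure.pi fun _ => nodeMeasure ι)) (errorEvent A x a n k i)) :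
    ENNReal.ofReal (1 / 32 * (Fintype.card ι / n)) ≤
      expectedLoss A ((nodeMeasure ι).map (labeledNode x a)) n := by
  set err := ∑ i, (A.seed.prod (Measure.pi fun _ : Fin n => nodeMeasure ι)) (errorEvent A x a n k i)
  have node_mass (i : ι) : nodeMeasure ι {(k, i)} = ENNReal.ofReal (1 / n) := by
    rw [← ofReal_measureReal, nodeMeasure_real_singleton, hn, one_div]
    push_cast
    rfl
  have err_ge : ENNReal.ofReal (Fintype.card ι / 32) ≤ err := by
    rw [← ENNReal.mul_le_mul_iff_right two_ne_zero ENNReal.ofNat_ne_top]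
    calc 2 * ENNReal.ofReal (Fintype.card ι / 32)
        = ∑ _i : ι, ENNReal.ofReal (1 / 16) := by
          rw [Finset.sum_const, Finset.card_univ, ← ENNReal.ofReal_nsmul, ← ENNReal.ofReal_ofNat,
            ← ENNReal.ofReal_mul zero_le_two, nsmul_eq_mul]
          congr 1
          ring
      _ ≤ ∑ i, nodeMeasure ι (otherNodes k i) ^ n := by
          gcongr with i
          exact hn ▸ one_div_sixteen_le_nodeMeasure_otherNodes_pow hk i
      _ ≤ 2 * err := ha
  calc ENNReal.ofReal (1 / 32 * (Fintype.card ι / n))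
      = ENNReal.ofReal (1 / n) * ENNReal.ofReal (Fintype.card ι / 32) := by
        rw [← ENNReal.ofReal_mul (by positivity)]
        congr 1
        ring
    _ ≤ ENNReal.ofReal (1 / n) * err := by gcongr
    _ = ∑ i, nodeMeasure ι {(k, i)} * (A.seed.prod (Measure.pi fun _ : Fin n => nodeMeasure ι))
          (errorEvent A x a n k i) := by simp only [node_mass, Finset.mul_sum, err]
    _ ≤ expectedLoss A ((nodeMeasure ι).map (labeledNode x a)) n :=
        sum_measure_singleton_mul_errorEvent_le_expectedLoss A _ a n k

theorem IsVCLTree.exists_realizable_infinite_le_expectedLoss {H : Set (X → Bool)}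
    (hx : IsVCLTree H x) (hH : ∀ h ∈ H, Measurable h) (A : LearningAlgorithm Ω X) :
    ∃ D ∈ Realizable H,
      {n : ℕ | ENNReal.ofReal (1 / 32 * (Fintype.card ι / n)) ≤ expectedLoss A D n}.Infinite := by
  obtain ⟨a, ha⟩ := hx.predictable.exists_forall_sum_le_two_mul_sum_errorEvent A (nodeMeasure ι)
    fun k => (Fintype.card ι + 1) ^ (k + 1)
  refine ⟨_, hx.map_labeledNode_mem_realizable hH (nodeMeasure ι) a, ?_⟩
  have sampleSize_injective : Function.Injective fun k => (Fintype.card ι + 1) ^ (k + 1 + 1) :=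
    (Nat.pow_right_injective (Nat.succ_le_succ Fintype.card_pos)).comp
      (add_left_injective 2)
  exact Set.infinite_of_injective_forall_mem sampleSize_injective fun k =>
    le_expectedLoss_of_sum_le_two_mul_sum_errorEvent A (Nat.le_add_left 1 k) rfl (ha (k + 1))

end LowerBound

section HalfSpaces

theorem measurable_of_mem_closedHalfSpaces {d : ℕ} {h : EuclideanSpace ℝ (Fin d) → Bool}
    (hh : h ∈ closedHalfSpaces d) : Measurable h := by
  obtain ⟨w, -, b, hb⟩ := hh
  have preimage_true : h ⁻¹' {true} = {x | b ≤ ⟪w, x⟫} := Set.ext hb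
  exact measurable_to_bool (preimage_true ▸ measurableSet_le measurable_const (by fun_prop))

/-- The partial sums of the binary expansion with digits `c`, shifted by one so that they are
positive. -/
noncomputable def dyadicSum (c : ℕ → Bool) (k : ℕ) : ℝ :=
  1 + ∑ j ∈ Finset.range k, if c j then (1 / 2) ^ (j + 1) else 0

theorem dyadicSum_succ (c : ℕ → Bool) (k : ℕ) :
    dyadicSum c (k + 1) = dyadicSum c k + if c k then (1 / 2) ^ (k + 1) else 0 := by
  rw [dyadicSum, dyadicSum, Finset.sum_range_succ, add_assoc]

theorem dyadicSum_congr {c c' : ℕ → Bool} {k : ℕ} (h : ∀ j < k, c j = c' j) :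
    dyadicSum c k = dyadicSum c' k := by
  unfold dyadicSum
  congr 1
  exact Finset.sum_congr rfl fun j hj => by rw [h j (Finset.mem_range.1 hj)]

theorem dyadicSum_pos (c : ℕ → Bool) (k : ℕ) : 0 < dyadicSum c k := by
  unfold dyadicSum
  have : 0 ≤ ∑ j ∈ Finset.range k, if c j then (1 / 2 : ℝ) ^ (j + 1) else 0 :=
    Finset.sum_nonneg fun j _ => by positivity
  linarith

theorem dyadicSum_mono (c : ℕ → Bool) : Monotone (dyadicSum c) := by
  refine monotone_nat_of_le_succ fun k => ?_
  rw [dyadicSum_succ, le_add_iff_nonneg_right]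
  positivity

theorem antitone_dyadicSum_add (c : ℕ → Bool) : Antitone fun k => dyadicSum c k + (1 / 2) ^ k := by
  refine antitone_nat_of_succ_le fun k => ?_
  have : (0 : ℝ) < (1 / 2) ^ k := by positivity
  rw [dyadicSum_succ, pow_succ]
  split_ifs <;> linarith

theorem dyadicSum_add_le_dyadicSum_iff (c : ℕ → Bool) {k m : ℕ} (hkm : k < m) :
    dyadicSum c k + (1 / 2) ^ (k + 1) ≤ dyadicSum c m ↔ c k = true := by
  constructor
  · contrapose!
    intro hc
    calc dyadicSum c m < dyadicSum c m + (1 / 2) ^ m := lt_add_of_pos_right _ (by positivity)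
      _ ≤ dyadicSum c (k + 1) + (1 / 2) ^ (k + 1) := antitone_dyadicSum_add c hkm
      _ = dyadicSum c k + (1 / 2) ^ (k + 1) := by rw [dyadicSum_succ, if_neg hc, add_zero]
  · intro hc
    calc dyadicSum c k + (1 / 2) ^ (k + 1) = dyadicSum c (k + 1) := by
          rw [dyadicSum_succ, if_pos hc]
      _ ≤ dyadicSum c m := dyadicSum_mono c hkm

/-- The point of the `i`-th axis that belongs to the half-space `{x | 1 ≤ ⟪w, x⟫}` if and only if
the `k`-th binary digit of `w i` is one, when the earlier digits of `w i` are the labels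
`a 0 i, …, a (k - 1) i`. -/
noncomputable def axisNode {ι : Type*} [DecidableEq ι] (a : ℕ → ι → Bool) (k : ℕ) (i : ι) :
    EuclideanSpace ℝ ι :=
  EuclideanSpace.single i (dyadicSum (a · i) k + (1 / 2) ^ (k + 1))⁻¹

theorem isPredictable_axisNode {ι : Type*} [DecidableEq ι] :
    IsPredictable (axisNode (ι := ι)) := fun a a' k h => by
  funext i
  rw [axisNode, axisNode, dyadicSum_congr fun j hj => congrFun (h j hj) i]

theorem one_le_inner_axisNode_iff {ι : Type*} [Fintype ι] [DecidableEq ι] (a : ℕ → ι → Bool)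
    {k m : ℕ} (hkm : k < m) (i : ι) :
    1 ≤ ⟪WithLp.toLp 2 fun j => dyadicSum (a · j) m, axisNode a k i⟫ ↔ a k i = true := by
  have threshold_pos : 0 < dyadicSum (a · i) k + (1 / 2) ^ (k + 1) :=
    add_pos (dyadicSum_pos _ k) (by positivity)
  rw [axisNode, EuclideanSpace.inner_single_right, conj_trivial, inv_mul_eq_div,
    one_le_div threshold_pos]
  exact dyadicSum_add_le_dyadicSum_iff (a · i) hkm

theorem isVCLTree_axisNode (d : ℕ) [NeZero d] :
    IsVCLTree (closedHalfSpaces d) (axisNode (ι := Fin d)) where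
  predictable := isPredictable_axisNode
  exists_mem_forall_lt_eq a m := by
    let w : EuclideanSpace ℝ (Fin d) := WithLp.toLp 2 fun i => dyadicSum (a · i) m
    have w_ne_zero : w ≠ 0 := fun hw =>
      (dyadicSum_pos (a · 0) m).ne' (congrArg (fun v : EuclideanSpace ℝ (Fin d) => v 0) hw)
    refine ⟨fun x => decide (1 ≤ ⟪w, x⟫), ⟨w, w_ne_zero, 1, fun x => decide_eq_true_iff⟩,
      fun k hk i => ?_⟩
    rw [Bool.eq_iff_iff, decide_eq_true_iff]
    exact one_le_inner_axisNode_iff a hk i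

end HalfSpaces

end LearningCurves

theorem mainTheorem2 :
    ∃ α : ℝ, 0 < α ∧ ∀ d : ℕ, 1 ≤ d →
      ∀ (Ω : Type*) [MeasurableSpace Ω]
        (A : LearningCurves.LearningAlgorithm Ω (EuclideanSpace ℝ (Fin d))),
        ∃ D ∈ LearningCurves.Realizable (LearningCurves.closedHalfSpaces d),
          {n : ℕ | ENNReal.ofReal (α * (d / n)) ≤ LearningCurves.expectedLoss A D n}.Infinite := by
  refine ⟨1 / 32, by norm_num, fun d hd Ω _ A => ?_⟩
  have : NeZero d := ⟨Nat.one_le_iff_ne_zero.1 hd⟩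
  simpa only [Fintype.card_fin] using
    (LearningCurves.isVCLTree_axisNode d).exists_realizable_infinite_le_expectedLoss
      (fun _ => LearningCurves.measurable_of_mem_closedHalfSpaces) A
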